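/- Let $(M,g)$ be a (pseudo-)Riemannian manifold with Levi-Civita connection $\nabla$, and let $S\to M$ be a (real or complex) spinor bundle, with Clifford multiplication $\gamma:TM\to\mathrm{End}(S)$, $\gamma(X)\gamma(Y)+\gamma(Y)\gamma(X)=-2g(X,Y)$, and charge conjugation $C$, i.e. a smooth non-degenerate bilinear form on $S$ with $C(\eta,\xi)=\Delta_0C(\xi,\eta)$ and $C(\eta,\gamma(X)\xi)=\Delta_1C(\xi,\gamma(X)\eta)$ for signs $\Delta_0,\Delta_1\in\{\pm1\}$. (The fibres of $S$ need not be irreducible Clifford modules.) For an endomorphism field $\Omega$ of $S$ let $\Omega^C$ be defined by $C(\Omega^C\eta,\xi)=C(\eta,\Omega\xi)$, and put $\mathrm{ad}^C(\Omega)\Phi=\mathrm{ad}^C_\Omega\Phi:=\Omega\Phi+\Phi\,\Omega^C$ for $\Phi\in\Gamma\,\mathrm{End}(S)$. Let $D$ be any connection on $S$, with curvature $R(X,Y)=[D_X,D_Y]-D_{[X,Y]}$. Let $D^C$ be the connection on $S$ determined by $X\,C(\eta,\xi)=C(D_X\eta,\xi)+C(\eta,D^C_X\xi)$. For an $\mathrm{End}(S)$-valued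 covariant tensor $\Phi$ of order $k$ define $$(\hat D_Z\Phi)(X_1,\dots,X_k)\xi:=D_Z\big(\Phi(X_1,\dots,X_k)\xi\big)-\sum_{i=1}^k\Phi(X_1,\dots,\nabla_ZX_i,\dots,X_k)\xi-\Phi(X_1,\dots,X_k)D^C_Z\xi ,$$ and let $D_Z\Phi$ be given by the same formula with $D^C$ replaced by $D$. Let square brackets around indices denote skew symmetrization with the factor $1/k!$, let $(\mathrm{ad}^C_R\gamma)_{\mu\nu\rho}:=\mathrm{ad}^C(R_{\mu\nu})\gamma_\rho$, and let the torsion of $D$ be twice the skew part of $\hat D\gamma$, i.e. $\mathcal T_{\mu\nu}:=2\hat D_{[\mu}\gamma_{\nu]}$. Then $$\hat D_{[\kappa}\mathcal T_{\mu\nu]}=\mathrm{ad}^C(R_{[\kappa\mu})\gamma_{\nu]},\qquad \hat D_{[\kappa}(\mathrm{ad}^C_R\gamma)_{\mu\nu\rho]}=\tfrac12\,\mathrm{ad}^C(R_{[\kappa\mu})\mathcal T_{\nu\rho]},\qquad D_{[\kappa}R_{\mu\nu]}=0 .$$ -/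

import Mathlib

open Bundle Manifold
open scoped ContDiff

noncomputable section

namespace SpinorTorsion

/-! ### Smooth sections, vector fields and connections

`M` is a finite-dimensional smooth manifold without boundary, modelled on the real vector space `E`.
A bundle over `M` is used through its `C^∞(M)`-module of global smooth sections. -/

section Connections

variable {E : Type*} [NormedAddCommGroup E] [NormedSpace ℝ E] [FiniteDimensional ℝ E]
  {M : Type*} [TopologicalSpace M] [ChartedSpace E M] [IsManifold 𝓘(ℝ, E) ∞ M]

variable (E M) in
/-- Smooth vector fields on `M`. -/
abbrev VField := Cₛ^∞⟮𝓘(ℝ, E); E, (TangentSpace 𝓘(ℝ, E) : M → Type _)⟯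

/-- The Lie bracket `[X, Y]` of smooth vector fields. -/
def lieBracket (X Y : VField E M) : VField E M :=
  ⟨VectorField.mlieBracket 𝓘(ℝ, E) X Y, by
    have : IsManifold 𝓘(ℝ, E) (((⊤ : ℕ∞) : ℕ∞ω) + 1) M := by
      simpa using (inferInstance : IsManifold 𝓘(ℝ, E) ∞ M)
    have : IsManifold 𝓘(ℝ, E) (minSmoothness ℝ 2) M := by
      simpa using (inferInstance : IsManifold 𝓘(ℝ, E) 2 M)
    exact ContDiff.mlieBracket_vectorField (m := ⊤) (n := ⊤) X.contMDiff Y.contMDiff (by simp)⟩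

variable {F : Type*} [NormedAddCommGroup F] [NormedSpace ℝ F]
  {S : M → Type*} [TopologicalSpace (TotalSpace F S)]
  [∀ x, AddCommGroup (S x)] [∀ x, Module ℝ (S x)]
  [∀ x, TopologicalSpace (S x)] [∀ x, IsTopologicalAddGroup (S x)] [∀ x, ContinuousSMul ℝ (S x)]
  [FiberBundle F S] [VectorBundle ℝ F S]

/-- `∇_X ξ`, as a smooth section, for a smooth connection `∇` on a vector bundle. -/
def along [ContMDiffVectorBundle ∞ F S 𝓘(ℝ, E)]
    (D : CovariantDerivative 𝓘(ℝ, E) F S) (hD : D.ContMDiffCovariantDerivative ∞)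
    (X : VField E M) (ξ : Cₛ^∞⟮𝓘(ℝ, E); F, S⟯) : Cₛ^∞⟮𝓘(ℝ, E); F, S⟯ :=
  ⟨fun x ↦ D ξ x (X x), by
    have h := hD.contMDiff.contMDiff (σ := ξ)
      (by simpa using ξ.contMDiff.contMDiffOn (s := Set.univ))
    exact ContMDiff.clm_bundle_apply (contMDiffOn_univ.mp h) X.contMDiff⟩

variable (E M) in
/-- A pseudo-Riemannian metric on `M`: a smooth family of non-degenerate symmetric bilinear forms
(of any signature) on the tangent spaces. -/
structure PseudoRiemannianMetric where
  val : ∀ x : M, LinearMap.BilinForm ℝ (TangentSpace 𝓘(ℝ, E) x)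
  symm : ∀ x v w, val x v w = val x w v
  nondegenerate : ∀ x, (val x).Nondegenerate
  contMDiff : ∀ X Y : VField E M, ContMDiff 𝓘(ℝ, E) 𝓘(ℝ, ℝ) ∞ fun x ↦ val x (X x) (Y x)

/-- `nabla` is the Levi-Civita connection of `g`: it is smooth, torsion free, and
`Z g(X, Y) = g(∇_Z X, Y) + g(X, ∇_Z Y)`. -/
structure IsLeviCivita (g : PseudoRiemannianMetric E M)
    (nabla : CovariantDerivative 𝓘(ℝ, E) E (TangentSpace 𝓘(ℝ, E) : M → Type _)) : Prop where
  contMDiff : nabla.ContMDiffCovariantDerivative ∞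
  torsion_eq_zero : nabla.torsion = 0
  metric : ∀ (Z X Y : VField E M) (x : M),
    mvfderiv 𝓘(ℝ, E) (fun y ↦ g.val y (X y) (Y y)) x (Z x) =
      g.val x (nabla X x (Z x)) (Y x) + g.val x (X x) (nabla Y x (Z x))

end Connections

/-! ### Spinor bundles and spinor connections

Spinors are real or complex: the scalar field of the fibres is `𝕜`, with `𝕜 = ℝ` or `𝕜 = ℂ`. The
bundle `S` is a smooth real vector bundle whose trivializations are moreover `𝕜`-linear. -/

section Spinors

variable (𝕜 : Type*) [RCLike 𝕜]
  {E : Type*} [NormedAddCommGroup E] [NormedSpace ℝ E] [FiniteDimensional ℝ E]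
  {M : Type*} [TopologicalSpace M] [ChartedSpace E M] [IsManifold 𝓘(ℝ, E) ∞ M]
  (F : Type*) [NormedAddCommGroup F] [NormedSpace ℝ F]
  (S : M → Type*) [TopologicalSpace (TotalSpace F S)]
  [∀ x, AddCommGroup (S x)] [∀ x, Module ℝ (S x)] [∀ x, Module 𝕜 (S x)]
  [∀ x, IsScalarTower ℝ 𝕜 (S x)]
  [∀ x, TopologicalSpace (S x)] [∀ x, IsTopologicalAddGroup (S x)] [∀ x, ContinuousSMul ℝ (S x)]
  [FiberBundle F S] [VectorBundle ℝ F S]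

/-- The structure of a spinor bundle over `(M, g)` on the vector bundle `S`: a Clifford
multiplication `γ` with `γ(X)γ(Y) + γ(Y)γ(X) = -2 g(X, Y)` and a charge conjugation `C`, i.e. a
smooth non-degenerate bilinear form with symmetries `C(η, ξ) = Δ₀ C(ξ, η)` and
`C(η, γ(X) ξ) = Δ₁ C(ξ, γ(X) η)`, where `Δ₀, Δ₁ ∈ {1, -1}` (so that `C` is invariant under
the identity component of the spin group). No irreducibility of the fibres is required, so that sums of
copies of the spinor bundle are covered as well. -/
structure SpinorStructure (g : PseudoRiemannianMetric E M) where
  γ : ∀ x : M, TangentSpace 𝓘(ℝ, E) x →ₗ[ℝ] Module.End 𝕜 (S x)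
  clifford : ∀ x v w, γ x v * γ x w + γ x w * γ x v = (-2 * g.val x v w) • (1 : Module.End 𝕜 (S x))
  contMDiff_γ : ∀ (X : VField E M) (ξ : Cₛ^∞⟮𝓘(ℝ, E); F, S⟯),
    ContMDiff 𝓘(ℝ, E) (𝓘(ℝ, E).prod 𝓘(ℝ, F)) ∞ fun x ↦ TotalSpace.mk' F x (γ x (X x) (ξ x))
  C : ∀ x : M, LinearMap.BilinForm 𝕜 (S x)
  nondegenerate : ∀ x, (C x).Nondegenerate
  contMDiff_C : ∀ η ξ : Cₛ^∞⟮𝓘(ℝ, E); F, S⟯,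
    ContMDiff 𝓘(ℝ, E) 𝓘(ℝ, 𝕜) ∞ fun x ↦ C x (η x) (ξ x)
  Δ₀ : ℤˣ
  Δ₁ : ℤˣ
  symm₀ : ∀ x η ξ, C x η ξ = (Δ₀ : ℤ) • C x ξ η
  symm₁ : ∀ x v η ξ, C x η (γ x v ξ) = (Δ₁ : ℤ) • C x ξ (γ x v η)

variable (E) in
/-- A smooth `𝕜`-linear connection on `S`. -/
structure SpinorConnection extends CovariantDerivative 𝓘(ℝ, E) F S where
  contMDiff : toCovariantDerivative.ContMDiffCovariantDerivative ∞
  smul_const : ∀ (c : 𝕜) (ξ : Cₛ^∞⟮𝓘(ℝ, E); F, S⟯) (x : M) (v : TangentSpace 𝓘(ℝ, E) x),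
    toFun (fun y ↦ c • ξ y) x v = c • toFun ξ x v

variable (E) in
/-- Covariant tensors of order `k` with values in `End(S)`, as operators
`(X₁, …, X_k, ξ) ↦ Φ(X₁, …, X_k) ξ` on vector fields and sections of `S`. -/
abbrev EndTensor (k : ℕ) :=
  (Fin k → VField E M) → Cₛ^∞⟮𝓘(ℝ, E); F, S⟯ → Cₛ^∞⟮𝓘(ℝ, E); F, S⟯

variable {𝕜 F S}

/-- Normalized skew symmetrization,
`Φ_{[μ₁…μ_k]} = (1/k!) ∑_σ sign(σ) Φ_{μ_{σ(1)}…μ_{σ(k)}}`. -/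
def alt {k : ℕ} (Φ : EndTensor E F S k) : EndTensor E F S k := fun X ξ ↦
  (k.factorial : ℝ)⁻¹ • ∑ σ : Equiv.Perm (Fin k), (Equiv.Perm.sign σ : ℤ) • Φ (X ∘ σ) ξ

/-- The covariant derivative of `End(S)`-valued tensors induced by `D₁` and `D₂` on `S` and `∇` on
vector fields: `(Z, X) ↦ D₁_Z (Φ(X)ξ) - Φ(∇_Z X)ξ - Φ(X) D₂_Z ξ`, where
`Φ(∇_Z X) = ∑ᵢ Φ(X₁, …, ∇_Z Xᵢ, …, X_k)`. The differentiating field `Z` is the first argument. -/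
def inducedD (nabla : VField E M → VField E M → VField E M)
    (D₁ D₂ : VField E M → Cₛ^∞⟮𝓘(ℝ, E); F, S⟯ → Cₛ^∞⟮𝓘(ℝ, E); F, S⟯)
    {k : ℕ} (Φ : EndTensor E F S k) : EndTensor E F S (k + 1) := fun W ξ ↦
  let Z : VField E M := W 0
  let X : Fin k → VField E M := fun i ↦ W i.succ
  D₁ Z (Φ X ξ) - ∑ i, Φ (Function.update X i (nabla Z (X i))) ξ - Φ X (D₂ Z ξ)

/-- The curvature `R(X, Y) ξ = D_X D_Y ξ - D_Y D_X ξ - D_{[X, Y]} ξ`. -/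
def curvature (D : VField E M → Cₛ^∞⟮𝓘(ℝ, E); F, S⟯ → Cₛ^∞⟮𝓘(ℝ, E); F, S⟯) : EndTensor E F S 2 :=
  fun X ξ ↦ D (X 0) (D (X 1) ξ) - D (X 1) (D (X 0) ξ) - D (lieBracket (X 0) (X 1)) ξ

namespace SpinorStructure

variable {g : PseudoRiemannianMetric E M} (𝒮 : SpinorStructure 𝕜 F S g)

/-- Clifford multiplication as an `End(S)`-valued one-form. -/
def gamma : EndTensor E F S 1 := fun X ξ ↦ ⟨fun x ↦ 𝒮.γ x (X 0 x) (ξ x), 𝒮.contMDiff_γ (X 0) ξ⟩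

/-- The charge adjoint `Ω^C` of an endomorphism field `Ω`: `Ω^C ξ` is the (unique) section with
`C(Ω^C ξ, η) = C(ξ, Ω η)` for all sections `η`. -/
def chargeAdjoint (Ω : Cₛ^∞⟮𝓘(ℝ, E); F, S⟯ → Cₛ^∞⟮𝓘(ℝ, E); F, S⟯)
    (ξ : Cₛ^∞⟮𝓘(ℝ, E); F, S⟯) : Cₛ^∞⟮𝓘(ℝ, E); F, S⟯ :=
  Classical.epsilon fun ζ : Cₛ^∞⟮𝓘(ℝ, E); F, S⟯ ↦
    ∀ (η : Cₛ^∞⟮𝓘(ℝ, E); F, S⟯) (x : M), 𝒮.C x (ζ x) (η x) = 𝒮.C x (ξ x) (Ω η x)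

/-- The connection `D^C`, for which `C` is parallel with respect to `D ⊗ 1 + 1 ⊗ D^C`:
`D^C_X ξ` is the (unique) section with `X C(η, ξ) = C(D_X η, ξ) + C(η, D^C_X ξ)` for all
sections `η`. -/
def chargeDual (D : VField E M → Cₛ^∞⟮𝓘(ℝ, E); F, S⟯ → Cₛ^∞⟮𝓘(ℝ, E); F, S⟯)
    (X : VField E M) (ξ : Cₛ^∞⟮𝓘(ℝ, E); F, S⟯) : Cₛ^∞⟮𝓘(ℝ, E); F, S⟯ :=
  Classical.epsilon fun ζ : Cₛ^∞⟮𝓘(ℝ, E); F, S⟯ ↦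
    ∀ (η : Cₛ^∞⟮𝓘(ℝ, E); F, S⟯) (x : M),
      mvfderiv 𝓘(ℝ, E) (fun y ↦ 𝒮.C y (η y) (ξ y)) x (X x) =
        𝒮.C x (D X η x) (ξ x) + 𝒮.C x (η x) (ζ x)

/-- `ad^C_Ω Φ = Ω Φ + Φ Ω^C` for an `End(S)`-valued two-tensor `Ω` and `k`-tensor `Φ`, as the
`(k + 2)`-tensor `ad^C(Ω_{μν}) Φ_{ρ…}`. -/
def adC (Ω : EndTensor E F S 2) {k : ℕ} (Φ : EndTensor E F S k) : EndTensor E F S (k + 2) :=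
  fun W ξ ↦
    let A := Ω ![W 0, W 1]
    let B := Φ fun i ↦ W i.succ.succ
    A (B ξ) + B (𝒮.chargeAdjoint A ξ)

end SpinorStructure

variable [ContMDiffVectorBundle ∞ F S 𝓘(ℝ, E)]

/-- `D_X ξ` for a spinor connection. -/
def SpinorConnection.apply (D : SpinorConnection 𝕜 E F S) :
    VField E M → Cₛ^∞⟮𝓘(ℝ, E); F, S⟯ → Cₛ^∞⟮𝓘(ℝ, E); F, S⟯ :=
  along D.toCovariantDerivative D.contMDiff

namespace SpinorStructure

variable {g : PseudoRiemannianMetric E M} (𝒮 : SpinorStructure 𝕜 F S g)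
  {nabla : CovariantDerivative 𝓘(ℝ, E) E (TangentSpace 𝓘(ℝ, E) : M → Type _)}
  (hLC : IsLeviCivita g nabla) (D : SpinorConnection 𝕜 E F S)

/-- The connection `D̂`:
`(D̂_Z Φ)(X) ξ = D_Z (Φ(X) ξ) - Φ(∇_Z X) ξ - Φ(X) D^C_Z ξ`, with `∇` the Levi-Civita connection. -/
def hatD {k : ℕ} (Φ : EndTensor E F S k) : EndTensor E F S (k + 1) :=
  inducedD (along nabla hLC.contMDiff) D.apply (𝒮.chargeDual D.apply) Φ

/-- The torsion of `D`: two times the skew symmetrization of `D̂γ`. -/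
def torsion : EndTensor E F S 2 := (2 : ℝ) • alt (𝒮.hatD hLC D 𝒮.gamma)

end SpinorStructure

end Spinors

end SpinorTorsion

end

noncomputable section

namespace SpinorTorsion

set_option linter.unusedSectionVars false

/-! ### Bianchi identities for formal connections -/

section Algebra

variable {E : Type*} [NormedAddCommGroup E] [NormedSpace ℝ E]
  {M : Type*} [TopologicalSpace M] [ChartedSpace E M] [IsManifold 𝓘(ℝ, E) ∞ M]
  {F : Type*} [NormedAddCommGroup F] [NormedSpace ℝ F]
  {S : M → Type*} [TopologicalSpace (TotalSpace F S)]
  [∀ x, AddCommGroup (S x)] [∀ x, Module ℝ (S x)]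
  [∀ x, TopologicalSpace (S x)]
  [FiberBundle F S] [VectorBundle ℝ F S]

/-! ### Skew symmetrization -/

/-! Let $R'$ be the curvature of $D^C$. Differentiating $C(\eta,\xi)$ twice and using $[X,Y]f = XYf
- YXf$ gives $R^C=-R'$, so $\mathrm{ad}^C_R\Phi = R\Phi-\Phi R'$: this is the curvature of the
connection induced on endomorphisms by $D$ on the target and $D^C$ on the source, and $\hat D$ is
that connection coupled to $\nabla$. The claims then become standard. The first is the Ricci
identity for $\hat D\hat D\gamma$ (`alt_inducedD_inducedD`); its Riemann term drops out by the first
Bianchi identity of $\nabla$. The third is the second Bianchi identity for $D$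
(`differential_bianchi`). The second is the Leibniz rule for $\hat D(R\gamma-\gamma R')$
(`alt_inducedD_commTensor`), with the terms in $DR$ and $D^CR'$ removed by that identity. These
computations need only additivity of the operators, torsion-freeness and the Jacobi identity, so
they are done for biadditive operators and finished by `abel`. The analysis lies in the existence of
$D^C$ on global sections: the functional $\eta\mapsto X\,C(\eta,\xi)-C(D_X\eta,\xi)$ is
$C^\infty$-linear, hence represented by a section (`exists_section_representing`,
`exists_chargeDual`). -/

/-- Permuting the arguments of a tensor. -/
def EndTensor.permute {k : ℕ} (Φ : EndTensor E F S k) (τ : Equiv.Perm (Fin k)) :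
    EndTensor E F S k := fun X ξ ↦ Φ (X ∘ τ) ξ

theorem alt_add {k : ℕ} (Φ Ψ : EndTensor E F S k) : alt (Φ + Ψ) = alt Φ + alt Ψ := by
  funext X ξ
  simp [alt, Finset.sum_add_distrib]

theorem alt_sub {k : ℕ} (Φ Ψ : EndTensor E F S k) : alt (Φ - Ψ) = alt Φ - alt Ψ := by
  funext X ξ
  simp [alt, smul_sub, Finset.sum_sub_distrib]

theorem alt_zero {k : ℕ} : alt (0 : EndTensor E F S k) = 0 := by
  funext X ξ
  simp [alt]

theorem alt_permute {k : ℕ} (Φ : EndTensor E F S k) (τ : Equiv.Perm (Fin k)) :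
    alt (Φ.permute τ) = (Equiv.Perm.sign τ : ℤ) • alt Φ := by
  funext X ξ
  simp only [alt, EndTensor.permute, Pi.smul_apply]
  rw [smul_comm]
  congr 1
  -- Reindex by $\sigma\mapsto\sigma\tau$; the sign of $\tau$ then appears squared.
  rw [Finset.smul_sum, ← Equiv.sum_comp (Equiv.mulRight τ) fun σ ↦
    (Equiv.Perm.sign τ : ℤ) • (Equiv.Perm.sign σ : ℤ) • Φ (X ∘ σ) ξ]
  refine Finset.sum_congr rfl fun σ _ ↦ ?_
  rw [smul_smul, Equiv.coe_mulRight, Equiv.Perm.sign_mul, mul_comm (Equiv.Perm.sign σ),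
    Units.val_mul, ← mul_assoc, ← Units.val_mul, Int.units_mul_self, Units.val_one, one_mul]
  rfl

theorem alt_sub_permute {k : ℕ} (Φ : EndTensor E F S k) {τ : Equiv.Perm (Fin k)}
    (hτ : Equiv.Perm.sign τ = -1) : alt (Φ - Φ.permute τ) = (2 : ℝ) • alt Φ := by
  rw [alt_sub, alt_permute, hτ, two_smul]
  simp

/-- A tensor whose cyclic sum over some even permutation of order three vanishes has no skew
part. -/
theorem alt_eq_zero_of_cyclic {k : ℕ} {Φ : EndTensor E F S k} {τ : Equiv.Perm (Fin k)}
    (hτ : Equiv.Perm.sign τ = 1)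
    (h : Φ + Φ.permute τ + Φ.permute (τ * τ) = 0) : alt Φ = 0 := by
  have h' := congrArg alt h
  rw [alt_add, alt_add, alt_permute, alt_permute, Equiv.Perm.sign_mul, hτ, alt_zero] at h'
  have h3 : (3 : ℝ) • alt Φ = 0 := by
    rw [← h']
    simp only [mul_one, Units.val_one, one_smul]
    module
  exact (smul_eq_zero.mp h3).resolve_left (by norm_num)

theorem two_smul_alt_two (Φ : EndTensor E F S 2) :
    (2 : ℝ) • alt Φ = Φ - Φ.permute (Equiv.swap 0 1) := by
  funext X ξ
  have hu : (Finset.univ : Finset (Equiv.Perm (Fin 2))) = {1, Equiv.swap 0 1} := by decide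
  have hne : (1 : Equiv.Perm (Fin 2)) ∉ ({Equiv.swap 0 1} : Finset _) := by decide
  simp only [alt, Pi.smul_apply, hu, Finset.sum_insert hne, Finset.sum_singleton,
    EndTensor.permute, Pi.sub_apply]
  rw [smul_smul]
  simp [sub_eq_add_neg]

/-! ### Formal covariant derivatives

The identities below hold for biadditive operators `N` on vector fields and `D`, `D'` on sections,
where `N` is torsion free. -/

variable {N : VField E M →+ VField E M →+ VField E M}
  {D D' : VField E M →+ Cₛ^∞⟮𝓘(ℝ, E); F, S⟯ →+ Cₛ^∞⟮𝓘(ℝ, E); F, S⟯}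
  {G : VField E M →+ Cₛ^∞⟮𝓘(ℝ, E); F, S⟯ →+ Cₛ^∞⟮𝓘(ℝ, E); F, S⟯}

theorem inducedD_one (n : VField E M → VField E M → VField E M)
    (d d' : VField E M → Cₛ^∞⟮𝓘(ℝ, E); F, S⟯ → Cₛ^∞⟮𝓘(ℝ, E); F, S⟯)
    (Φ : EndTensor E F S 1) (W : Fin 2 → VField E M) (ξ : Cₛ^∞⟮𝓘(ℝ, E); F, S⟯) :
    inducedD n d d' Φ W ξ =
      d (W 0) (Φ ![W 1] ξ) - Φ ![n (W 0) (W 1)] ξ - Φ ![W 1] (d' (W 0) ξ) := by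
  have h₀ : (fun i : Fin 1 ↦ W i.succ) = ![W 1] := by ext i; fin_cases i; rfl
  simp only [inducedD, h₀, Fin.sum_univ_one]
  congr 3
  ext i; fin_cases i; rfl

theorem inducedD_two (n : VField E M → VField E M → VField E M)
    (d d' : VField E M → Cₛ^∞⟮𝓘(ℝ, E); F, S⟯ → Cₛ^∞⟮𝓘(ℝ, E); F, S⟯)
    (Φ : EndTensor E F S 2) (W : Fin 3 → VField E M) (ξ : Cₛ^∞⟮𝓘(ℝ, E); F, S⟯) :
    inducedD n d d' Φ W ξ =
      d (W 0) (Φ ![W 1, W 2] ξ) -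
        (Φ ![n (W 0) (W 1), W 2] ξ + Φ ![W 1, n (W 0) (W 2)] ξ) -
        Φ ![W 1, W 2] (d' (W 0) ξ) := by
  have h₀ : (fun i : Fin 2 ↦ W i.succ) = ![W 1, W 2] := by ext i; fin_cases i <;> rfl
  have h₁ (X Y Z : VField E M) : Function.update ![X, Y] 0 Z = ![Z, Y] := by
    ext i; fin_cases i <;> rfl
  have h₂ (X Y Z : VField E M) : Function.update ![X, Y] 1 Z = ![X, Z] := by
    ext i; fin_cases i <;> rfl
  simp [inducedD, h₀, Fin.sum_univ_two, h₁, h₂]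

theorem inducedD_three (n : VField E M → VField E M → VField E M)
    (d d' : VField E M → Cₛ^∞⟮𝓘(ℝ, E); F, S⟯ → Cₛ^∞⟮𝓘(ℝ, E); F, S⟯)
    (Φ : EndTensor E F S 3) (W : Fin 4 → VField E M) (ξ : Cₛ^∞⟮𝓘(ℝ, E); F, S⟯) :
    inducedD n d d' Φ W ξ =
      d (W 0) (Φ ![W 1, W 2, W 3] ξ) -
        (Φ ![n (W 0) (W 1), W 2, W 3] ξ + Φ ![W 1, n (W 0) (W 2), W 3] ξ +
          Φ ![W 1, W 2, n (W 0) (W 3)] ξ) -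
        Φ ![W 1, W 2, W 3] (d' (W 0) ξ) := by
  have h₀ : (fun i : Fin 3 ↦ W i.succ) = ![W 1, W 2, W 3] := by ext i; fin_cases i <;> rfl
  have h₁ (X Y Z T : VField E M) : Function.update ![X, Y, Z] 0 T = ![T, Y, Z] := by
    ext i; fin_cases i <;> rfl
  have h₂ (X Y Z T : VField E M) : Function.update ![X, Y, Z] 1 T = ![X, T, Z] := by
    ext i; fin_cases i <;> rfl
  have h₃ (X Y Z T : VField E M) : Function.update ![X, Y, Z] 2 T = ![X, Y, T] := by
    ext i; fin_cases i <;> rfl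
  simp [inducedD, h₀, Fin.sum_univ_three, h₁, h₂, h₃]

/-- The action of additive endomorphism fields as a one-tensor. -/
def oneTensor (G : VField E M →+ Cₛ^∞⟮𝓘(ℝ, E); F, S⟯ →+ Cₛ^∞⟮𝓘(ℝ, E); F, S⟯) : EndTensor E F S 1 :=
  fun X ξ ↦ G (X 0) ξ

/-- The curvature written through a torsion free connection, additive in each argument. -/
def torsionFreeCurvature (N : VField E M →+ VField E M →+ VField E M)
    (D : VField E M →+ Cₛ^∞⟮𝓘(ℝ, E); F, S⟯ →+ Cₛ^∞⟮𝓘(ℝ, E); F, S⟯) : EndTensor E F S 2 :=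
  fun X ξ ↦ D (X 0) (D (X 1) ξ) - D (X 1) (D (X 0) ξ) - D (N (X 0) (X 1) - N (X 1) (X 0)) ξ

/-- The commutator `R Φ - Φ R'`, for two-tensors `R` and `R'`. -/
def commTensor (R R' : EndTensor E F S 2) {k : ℕ} (Φ : EndTensor E F S k) :
    EndTensor E F S (k + 2) := fun W ξ ↦
  R ![W 0, W 1] (Φ (fun i ↦ W i.succ.succ) ξ) - Φ (fun i ↦ W i.succ.succ) (R' ![W 0, W 1] ξ)

/-- The Jacobi identity for the bracket `N X Y - N Y X`. -/
def SatisfiesJacobi (N : VField E M →+ VField E M →+ VField E M) : Prop :=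
  ∀ X Y Z, N X (N Y Z - N Z Y) - N (N Y Z - N Z Y) X + (N Y (N Z X - N X Z) - N (N Z X - N X Z) Y) +
    (N Z (N X Y - N Y X) - N (N X Y - N Y X) Z) = 0

/-- Products of three $D$'s cancel cyclically. The products of two cancel because the bracket is the
commutator of $N$; what remains is $-D$ applied to the Jacobi sum. -/
theorem inducedD_curvature_cyclic (hN : SatisfiesJacobi N) (X Y Z : VField E M)
    (ξ : Cₛ^∞⟮𝓘(ℝ, E); F, S⟯) :
    let B := inducedD (fun X Y ↦ N X Y) (fun X ξ ↦ D X ξ) (fun X ξ ↦ D X ξ)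
      (torsionFreeCurvature N D)
    B ![X, Y, Z] ξ + B ![Y, Z, X] ξ + B ![Z, X, Y] ξ = 0 := by
  have hJ := congrArg (fun X ↦ D X ξ) (hN X Y Z)
  simp only [inducedD_two, torsionFreeCurvature, Matrix.cons_val, map_sub, map_add,
    AddMonoidHom.sub_apply, AddMonoidHom.add_apply, map_zero, AddMonoidHom.zero_apply] at hJ ⊢
  rw [← neg_eq_zero, ← hJ]
  abel

theorem differential_bianchi (hN : SatisfiesJacobi N) :
    alt (inducedD (fun X Y ↦ N X Y) (fun X ξ ↦ D X ξ) (fun X ξ ↦ D X ξ)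
      (torsionFreeCurvature N D)) = 0 := by
  refine alt_eq_zero_of_cyclic (τ := finRotate 3) (by decide) ?_
  funext W ξ
  have h₀ : W = ![W 0, W 1, W 2] := by ext i; fin_cases i <;> rfl
  have h₁ : W ∘ finRotate 3 = ![W 1, W 2, W 0] := by ext i; fin_cases i <;> rfl
  have h₂ : W ∘ (finRotate 3 * finRotate 3 : Equiv.Perm (Fin 3)) = ![W 2, W 0, W 1] := by
    ext i; fin_cases i <;> rfl
  simp only [EndTensor.permute, Pi.add_apply, h₁, h₂]
  nth_rewrite 1 [h₀]
  exact inducedD_curvature_cyclic hN _ _ _ ξ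

/-- Ricci identity: antisymmetrizing the two derivatives leaves the curvature commutator minus $G$
of the Riemann tensor of $N$ (the tensor `K`). The skew part of `K` vanishes by the first Bianchi
identity, which for a torsion-free $N$ is the Jacobi identity. -/
theorem alt_inducedD_inducedD (hN : SatisfiesJacobi N) :
    (2 : ℝ) • alt (inducedD (fun X Y ↦ N X Y) (fun X ξ ↦ D X ξ) (fun X ξ ↦ D' X ξ)
      (inducedD (fun X Y ↦ N X Y) (fun X ξ ↦ D X ξ) (fun X ξ ↦ D' X ξ) (oneTensor G))) =
    alt (commTensor (torsionFreeCurvature N D) (torsionFreeCurvature N D') (oneTensor G)) := by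
  rw [← alt_sub_permute _ (τ := Equiv.swap 0 1) (by decide)]
  let K : EndTensor E F S 3 := fun W ξ ↦
    G (N (W 0) (N (W 1) (W 2)) - N (W 1) (N (W 0) (W 2)) -
      N (N (W 0) (W 1) - N (W 1) (W 0)) (W 2)) ξ
  have hK : alt K = 0 := by
    refine alt_eq_zero_of_cyclic (τ := finRotate 3) (by decide) ?_
    funext W ξ
    have r0 : finRotate 3 0 = 1 := rfl
    have r1 : finRotate 3 1 = 2 := rfl
    have r2 : finRotate 3 2 = 0 := rfl
    have hJ := congrArg (fun X ↦ G X ξ) (hN (W 0) (W 1) (W 2))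
    simp only [EndTensor.permute, Pi.add_apply, K,
      Function.comp_apply, Equiv.Perm.mul_apply, r0, r1, r2, map_sub, map_add,
      AddMonoidHom.sub_apply, AddMonoidHom.add_apply,
      map_zero, AddMonoidHom.zero_apply, Pi.zero_apply] at hJ ⊢
    rw [← hJ]
    abel
  rw [← sub_zero (alt (commTensor _ _ _)), ← hK, ← alt_sub]
  congr 1
  funext W ξ
  have s0 : Equiv.swap (0 : Fin 3) 1 0 = 1 := rfl
  have s1 : Equiv.swap (0 : Fin 3) 1 1 = 0 := rfl
  have s2 : Equiv.swap (0 : Fin 3) 1 2 = 2 := rfl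
  have f0 : (Fin.succ (Fin.succ (0 : Fin 1)) : Fin 3) = 2 := rfl
  simp only [EndTensor.permute, Pi.sub_apply, K, inducedD_two, inducedD_one, torsionFreeCurvature,
    Function.comp_apply, s0, s1, s2, f0, Matrix.cons_val_zero, commTensor, oneTensor,
    Matrix.cons_val_one, map_sub, AddMonoidHom.sub_apply]
  abel

theorem alt_inducedD_torsion (Φ : EndTensor E F S 2) :
    alt (inducedD (fun X Y ↦ N X Y) (fun X ξ ↦ D X ξ) (fun X ξ ↦ D' X ξ) ((2 : ℝ) • alt Φ)) =
      (2 : ℝ) • alt (inducedD (fun X Y ↦ N X Y) (fun X ξ ↦ D X ξ) (fun X ξ ↦ D' X ξ) Φ) := by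
  -- The differentiating field takes slot 0, so the inner swap of slots 0 and 1 becomes a swap of 1
  -- and 2.
  rw [two_smul_alt_two, ← alt_sub_permute _ (τ := Equiv.swap 1 2) (by decide)]
  congr 1
  funext W ξ
  have s0 : Equiv.swap (1 : Fin 3) 2 0 = 0 := rfl
  have s1 : Equiv.swap (1 : Fin 3) 2 1 = 2 := rfl
  have s2 : Equiv.swap (1 : Fin 3) 2 2 = 1 := rfl
  have hs (X Y : VField E M) : ![X, Y] ∘ Equiv.swap (0 : Fin 2) 1 = ![Y, X] := by
    ext i; fin_cases i <;> rfl
  simp only [EndTensor.permute, Pi.sub_apply, inducedD_two, Function.comp_apply, s0, s1, s2, hs,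
    map_sub]
  abel

theorem alt_commTensor_torsion (R R' : EndTensor E F S 2)
    (hR : ∀ X ξ η, R X (ξ - η) = R X ξ - R X η) (Φ : EndTensor E F S 2) :
    alt (commTensor R R' ((2 : ℝ) • alt Φ)) = (2 : ℝ) • alt (commTensor R R' Φ) := by
  -- Here the two curvature slots come first, shifting the inner swap by two.
  rw [two_smul_alt_two, ← alt_sub_permute _ (τ := Equiv.swap 2 3) (by decide)]
  congr 1
  funext W ξ
  have s0 : Equiv.swap (2 : Fin 4) 3 0 = 0 := rfl
  have s1 : Equiv.swap (2 : Fin 4) 3 1 = 1 := rfl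
  have hs : (fun i : Fin 2 ↦ W i.succ.succ) ∘ Equiv.swap (0 : Fin 2) 1 =
      fun i ↦ W (Equiv.swap 2 3 i.succ.succ) := by
    ext i; fin_cases i <;> rfl
  simp only [EndTensor.permute, Pi.sub_apply, commTensor, Function.comp_apply, s0, s1, hs, hR]
  abel

theorem alt_inducedD_commTensor (hN : SatisfiesJacobi N) :
    alt (inducedD (fun X Y ↦ N X Y) (fun X ξ ↦ D X ξ) (fun X ξ ↦ D' X ξ)
      (commTensor (torsionFreeCurvature N D) (torsionFreeCurvature N D') (oneTensor G))) =
    alt (commTensor (torsionFreeCurvature N D) (torsionFreeCurvature N D')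
      (inducedD (fun X Y ↦ N X Y) (fun X ξ ↦ D X ξ) (fun X ξ ↦ D' X ξ) (oneTensor G))) := by
  let B := inducedD (fun X Y ↦ N X Y) (fun X ξ ↦ D X ξ) (fun X ξ ↦ D X ξ)
    (torsionFreeCurvature N D)
  let B' := inducedD (fun X Y ↦ N X Y) (fun X ξ ↦ D' X ξ) (fun X ξ ↦ D' X ξ)
    (torsionFreeCurvature N D')
  -- `P` collects the Leibniz terms in which a curvature is differentiated; its cyclic sum over the
  -- first three slots vanishes by the second Bianchi identities of `D` and `D'`.
  let P : EndTensor E F S 4 := fun W ξ ↦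
    B ![W 0, W 1, W 2] (G (W 3) ξ) - G (W 3) (B' ![W 0, W 1, W 2] ξ)
  -- The 3-cycle fixing slot 3. It also moves the indices of $R_{\mu\nu}\hat D_\kappa\gamma_\rho$
  -- into the order $\kappa\mu\nu\rho$, and being even it does not change the skew part.
  let c : Equiv.Perm (Fin 4) := Equiv.swap 0 1 * Equiv.swap 1 2
  have c0 : c 0 = 1 := rfl
  have c1 : c 1 = 2 := rfl
  have c2 : c 2 = 0 := rfl
  have c3 : c 3 = 3 := rfl
  have hc : Equiv.Perm.sign c = 1 := by decide
  have hP : alt P = 0 := by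
    refine alt_eq_zero_of_cyclic (τ := c) hc ?_
    funext W ξ
    have h := inducedD_curvature_cyclic (D := D) hN (W 0) (W 1) (W 2) (G (W 3) ξ)
    have h' := congrArg (G (W 3)) (inducedD_curvature_cyclic (D := D') hN (W 0) (W 1) (W 2) ξ)
    rw [map_add, map_add, map_zero] at h'
    have h'' := congrArg₂ (· - ·) h h'
    simp only [sub_zero] at h''
    simp only [EndTensor.permute, Pi.add_apply, P, Function.comp_apply, Equiv.Perm.mul_apply,
      c0, c1, c2, c3, Pi.zero_apply]
    rw [← h'']
    abel
  set H := inducedD (fun X Y ↦ N X Y) (fun X ξ ↦ D X ξ) (fun X ξ ↦ D' X ξ) (oneTensor G) with hH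
  have hQ := alt_permute (commTensor (torsionFreeCurvature N D) (torsionFreeCurvature N D') H) c
  rw [hc, Units.val_one, one_smul] at hQ
  rw [← hQ, ← zero_add (alt (EndTensor.permute _ _)), ← hP, ← alt_add]
  congr 1
  funext W ξ
  have f0 : (Fin.succ (Fin.succ (0 : Fin 1)) : Fin 3) = 2 := rfl
  have hs : (fun i : Fin 2 ↦ W (c i.succ.succ)) = ![W 0, W 3] := by
    ext i; fin_cases i <;> rfl
  simp only [EndTensor.permute, Pi.add_apply, P, B, B', hH, inducedD_three, inducedD_two,
    inducedD_one, torsionFreeCurvature, Function.comp_apply, c0, c1, hs, f0, commTensor,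
    oneTensor, Matrix.cons_val, map_sub, map_add, AddMonoidHom.sub_apply]
  abel

end Algebra

section Analysis

variable {E : Type*} [NormedAddCommGroup E] [NormedSpace ℝ E] [FiniteDimensional ℝ E]
  {M : Type*} [TopologicalSpace M] [ChartedSpace E M] [IsManifold 𝓘(ℝ, E) ∞ M]

/-! ### Derivatives of functions along vector fields -/

section Functions

variable {W : Type*} [NormedAddCommGroup W] [NormedSpace ℝ W]

theorem contMDiff_mvfderiv {f : M → W} (hf : ContMDiff 𝓘(ℝ, E) 𝓘(ℝ, W) ∞ f) (X : VField E M) :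
    ContMDiff 𝓘(ℝ, E) 𝓘(ℝ, W) ∞ fun x ↦ mvfderiv 𝓘(ℝ, E) f x (X x) := by
  have h := (hf.contMDiff_tangentMap (m := ∞) (by simp)).comp X.contMDiff
  intro x
  exact ((contMDiff_snd_tangentBundle_modelSpace W 𝓘(ℝ, W)).contMDiffAt).comp x (h x)

theorem mvfderiv_clm_comp {W' : Type*} [NormedAddCommGroup W'] [NormedSpace ℝ W'] (φ : W →L[ℝ] W')
    {f : M → W} {x : M} (hf : MDifferentiableAt 𝓘(ℝ, E) 𝓘(ℝ, W) f x)
    (v : TangentSpace 𝓘(ℝ, E) x) :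
    mvfderiv 𝓘(ℝ, E) (fun y ↦ φ (f y)) x v = φ (mvfderiv 𝓘(ℝ, E) f x v) := by
  have h := mfderiv_comp x (g := φ) (I' := 𝓘(ℝ, W)) (I'' := 𝓘(ℝ, W'))
    φ.mdifferentiableAt hf
  have h' : mfderiv 𝓘(ℝ, W) 𝓘(ℝ, W') φ (f x) = φ := by
    rw [mfderiv_eq_fderiv]; exact φ.fderiv
  have := congrArg (fun T ↦ T v) h
  simp only [h'] at this
  exact this

theorem lieBracket_apply (X Y : VField E M) (x : M) :
    lieBracket X Y x = VectorField.mlieBracket 𝓘(ℝ, E) X Y x := rfl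

theorem mdifferentiableAt_section {F : Type*} [NormedAddCommGroup F] [NormedSpace ℝ F]
    {S : M → Type*} [TopologicalSpace (TotalSpace F S)] [∀ x, TopologicalSpace (S x)]
    [FiberBundle F S] (ξ : Cₛ^∞⟮𝓘(ℝ, E); F, S⟯) (x : M) :
    MDifferentiableAt 𝓘(ℝ, E) (𝓘(ℝ, E).prod 𝓘(ℝ, F)) (fun y ↦ TotalSpace.mk' F y (ξ y)) x :=
  (ξ.contMDiff x).mdifferentiableAt (by simp)

theorem lieBracket_jacobi (X Y Z : VField E M) :
    lieBracket X (lieBracket Y Z) = lieBracket (lieBracket X Y) Z + lieBracket Y (lieBracket X Z) := by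
  have : IsManifold 𝓘(ℝ, E) (minSmoothness ℝ 3) M := by
    simpa using (inferInstance : IsManifold 𝓘(ℝ, E) 3 M)
  have hs (X : VField E M) : ContMDiff 𝓘(ℝ, E) (𝓘(ℝ, E).prod 𝓘(ℝ, E)) (minSmoothness ℝ 2)
      (fun y ↦ TotalSpace.mk' E y (X y)) := by
    refine X.contMDiff.of_le ?_
    simp only [minSmoothness_of_isRCLikeNormedField]
    exact ENat.LEInfty.out
  ext x
  exact congrFun (VectorField.leibniz_identity_mlieBracket (hs X) (hs Y) (hs Z)) x

theorem lieBracket_smul_right (X Z Z' : VField E M) {f : M → ℝ}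
    (hf : ContMDiff 𝓘(ℝ, E) 𝓘(ℝ, ℝ) ∞ f) (hZ : ∀ x, Z' x = f x • Z x) (x : M) :
    lieBracket X Z' x = mvfderiv 𝓘(ℝ, E) f x (X x) • Z x + f x • lieBracket X Z x := by
  have : IsManifold 𝓘(ℝ, E) 2 M := inferInstance
  have h : ⇑Z' = f • ⇑Z := funext hZ
  rw [lieBracket_apply, h]
  exact VectorField.mlieBracket_smul_right ((hf x).mdifferentiableAt (by simp))
    (mdifferentiableAt_section Z x)

theorem lieBracket_add_right (X Y Z : VField E M) :
    lieBracket X (Y + Z) = lieBracket X Y + lieBracket X Z := by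
  have : IsManifold 𝓘(ℝ, E) 2 M := inferInstance
  ext x
  exact VectorField.mlieBracket_add_right (mdifferentiableAt_section Y x)
    (mdifferentiableAt_section Z x)

/-- Product of a smooth function and a smooth section. -/
def functionSMul {F : Type*} [NormedAddCommGroup F] [NormedSpace ℝ F]
    {S : M → Type*} [TopologicalSpace (TotalSpace F S)] [∀ x, AddCommGroup (S x)]
    [∀ x, Module ℝ (S x)] [∀ x, TopologicalSpace (S x)]
    [FiberBundle F S] [VectorBundle ℝ F S] (f : M → ℝ)
    (hf : ContMDiff 𝓘(ℝ, E) 𝓘(ℝ, ℝ) ∞ f) (ξ : Cₛ^∞⟮𝓘(ℝ, E); F, S⟯) : Cₛ^∞⟮𝓘(ℝ, E); F, S⟯ :=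
  ⟨f • ⇑ξ, hf.smul_section ξ.contMDiff⟩

theorem functionSMul_apply {F : Type*} [NormedAddCommGroup F] [NormedSpace ℝ F]
    {S : M → Type*} [TopologicalSpace (TotalSpace F S)] [∀ x, AddCommGroup (S x)]
    [∀ x, Module ℝ (S x)] [∀ x, TopologicalSpace (S x)]
    [FiberBundle F S] [VectorBundle ℝ F S] (f : M → ℝ)
    (hf : ContMDiff 𝓘(ℝ, E) 𝓘(ℝ, ℝ) ∞ f) (ξ : Cₛ^∞⟮𝓘(ℝ, E); F, S⟯) (x : M) :
    functionSMul f hf ξ x = f x • ξ x := rfl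

/-- The commutator of the derivations `X` and `Y` is the derivation `[X, Y]`. -/
theorem mvfderiv_lieBracket_real {f : M → ℝ} (hf : ContMDiff 𝓘(ℝ, E) 𝓘(ℝ, ℝ) ∞ f)
    (X Y : VField E M) (x : M) :
    mvfderiv 𝓘(ℝ, E) f x (lieBracket X Y x) =
      mvfderiv 𝓘(ℝ, E) (fun y ↦ mvfderiv 𝓘(ℝ, E) f y (Y y)) x (X x) -
      mvfderiv 𝓘(ℝ, E) (fun y ↦ mvfderiv 𝓘(ℝ, E) f y (X y)) x (Y x) := by
  -- Expand the Jacobi identity for $X$, $Y$, $fZ$ by the Leibniz rule: all that survives is the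
  -- defect of the claim times $Z$.
  have key (Z : VField E M) : (mvfderiv 𝓘(ℝ, E) f x (lieBracket X Y x) -
      (mvfderiv 𝓘(ℝ, E) (fun y ↦ mvfderiv 𝓘(ℝ, E) f y (Y y)) x (X x) -
      mvfderiv 𝓘(ℝ, E) (fun y ↦ mvfderiv 𝓘(ℝ, E) f y (X y)) x (Y x))) • Z x = 0 := by
    have hb (X : VField E M) : lieBracket X (functionSMul f hf Z) =
        functionSMul _ (contMDiff_mvfderiv hf X) Z + functionSMul f hf (lieBracket X Z) := by
      ext y
      exact lieBracket_smul_right X Z _ hf (functionSMul_apply f hf Z) y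
    have hJ := congrArg (fun Z ↦ Z x) (lieBracket_jacobi X Y (functionSMul f hf Z))
    simp only [hb, lieBracket_add_right, ContMDiffSection.coe_add, Pi.add_apply,
      functionSMul_apply] at hJ
    rw [lieBracket_smul_right X Z _ (contMDiff_mvfderiv hf Y) (functionSMul_apply _ _ Z),
      lieBracket_smul_right Y Z _ (contMDiff_mvfderiv hf X) (functionSMul_apply _ _ Z),
      lieBracket_smul_right X (lieBracket Y Z) _ hf (functionSMul_apply _ _ _),
      lieBracket_smul_right Y (lieBracket X Z) _ hf (functionSMul_apply _ _ _),
      lieBracket_jacobi X Y Z, ContMDiffSection.coe_add, Pi.add_apply] at hJ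
    rw [← sub_eq_zero] at hJ
    rw [← neg_eq_zero, ← hJ]
    module
  -- Take for $Z$ whichever of $X$, $Y$ is nonzero at $x$; if both vanish there, so does $[X,Y]$ and
  -- every term is zero.
  by_cases hX : X x = 0
  · by_cases hY : Y x = 0
    · have h0 : lieBracket X Y x = 0 := by
        rw [lieBracket_apply, ← VectorField.mlieBracketWithin_univ]
        exact VectorField.mlieBracketWithin_eq_zero_of_eq_zero hX hY
      rw [h0, hX, hY]
      simp
    · exact sub_eq_zero.mp ((smul_eq_zero.mp (key Y)).resolve_right hY)
  · exact sub_eq_zero.mp ((smul_eq_zero.mp (key X)).resolve_right hX)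

theorem mvfderiv_lieBracket {f : M → W} (hf : ContMDiff 𝓘(ℝ, E) 𝓘(ℝ, W) ∞ f)
    (X Y : VField E M) (x : M) :
    mvfderiv 𝓘(ℝ, E) f x (lieBracket X Y x) =
      mvfderiv 𝓘(ℝ, E) (fun y ↦ mvfderiv 𝓘(ℝ, E) f y (Y y)) x (X x) -
      mvfderiv 𝓘(ℝ, E) (fun y ↦ mvfderiv 𝓘(ℝ, E) f y (X y)) x (Y x) := by
  rw [← sub_eq_zero]
  refine SeparatingDual.eq_zero_of_forall_dual_eq_zero (R := ℝ) fun φ ↦ ?_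
  have hd {h : M → W} (hh : ContMDiff 𝓘(ℝ, E) 𝓘(ℝ, W) ∞ h) (y : M) :=
    (hh y).mdifferentiableAt (by simp)
  have h := mvfderiv_lieBracket_real (φ.contMDiff.comp hf) X Y x
  simp only [Function.comp_def, mvfderiv_clm_comp φ (hd hf _),
    mvfderiv_clm_comp φ (hd (contMDiff_mvfderiv hf _) _)] at h
  rw [map_sub, map_sub, h, sub_self]

end Functions

end Analysis

section Sections

open Filter Topology

variable {E : Type*} [NormedAddCommGroup E] [NormedSpace ℝ E] [FiniteDimensional ℝ E]
  {M : Type*} [TopologicalSpace M] [T2Space M] [ChartedSpace E M] [IsManifold 𝓘(ℝ, E) ∞ M]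
  {F : Type*} [NormedAddCommGroup F] [NormedSpace ℝ F] [FiniteDimensional ℝ F]
  {S : M → Type*} [TopologicalSpace (TotalSpace F S)]
  [∀ x, AddCommGroup (S x)] [∀ x, Module ℝ (S x)]
  [∀ x, TopologicalSpace (S x)]
  [FiberBundle F S] [VectorBundle ℝ F S] [ContMDiffVectorBundle ∞ F S 𝓘(ℝ, E)]

/-! ### Global sections from local frames -/

/-- Near each point there is a frame of global smooth sections; after multiplication by a bump
function, every section is a combination of the frame with globally smooth coefficients. -/
theorem exists_global_frame (x₀ : M) :
    ∃ (e : Fin (Module.finrank ℝ F) → Cₛ^∞⟮𝓘(ℝ, E); F, S⟯) (ψ : M → ℝ),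
      (∀ᶠ x in 𝓝 x₀, ψ x = 1 ∧ LinearIndependent ℝ (fun i ↦ e i x) ∧
        ⊤ ≤ Submodule.span ℝ (Set.range fun i ↦ e i x)) ∧
      ContMDiff 𝓘(ℝ, E) 𝓘(ℝ, ℝ) ∞ ψ ∧
      ∀ η : Cₛ^∞⟮𝓘(ℝ, E); F, S⟯, ∃ a : Fin (Module.finrank ℝ F) → M → ℝ,
        (∀ i, ContMDiff 𝓘(ℝ, E) 𝓘(ℝ, ℝ) ∞ (a i)) ∧
        ∀ x, ψ x • η x = ∑ i, a i x • e i x := by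
  have : ContMDiffVectorBundle 1 F S 𝓘(ℝ, E) :=
    ContMDiffVectorBundle.of_le (n := ∞) ENat.LEInfty.out
  let t := trivializationAt F S x₀
  let b := Module.finBasis ℝ F
  have hx₀ : t.baseSet ∈ 𝓝 x₀ :=
    t.open_baseSet.mem_nhds (FiberBundle.mem_baseSet_trivializationAt' x₀)
  obtain ⟨f, -, hf⟩ := (SmoothBumpFunction.nhds_basis_tsupport (I := 𝓘(ℝ, E)) x₀).mem_iff.mp hx₀
  have hfs : ContMDiff 𝓘(ℝ, E) 𝓘(ℝ, ℝ) ∞ f := f.contMDiff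
  have hf0 {x : M} (hx : x ∉ t.baseSet) : f x = 0 := by
    by_contra h
    exact hx (hf (subset_tsupport f h))
  let e (i : Fin (Module.finrank ℝ F)) : Cₛ^∞⟮𝓘(ℝ, E); F, S⟯ :=
    ⟨⇑f • t.localFrame b i, hfs.contMDiffOn.smul_section_of_tsupport t.open_baseSet hf
      (t.contMDiffOn_localFrame_baseSet ∞ b i)⟩
  have he (i x) : e i x = f x • t.localFrame b i x := rfl
  -- The cutoff is the square of the bump function: one factor makes the frame global, the other the
  -- coefficients.
  refine ⟨e, fun x ↦ f x * f x, ?_, hfs.mul hfs, fun η ↦ ⟨fun i x ↦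
    f x * t.localFrameCoeff 𝓘(ℝ, E) b i x (η x), fun i ↦ ?_, fun x ↦ ?_⟩⟩
  · filter_upwards [f.eventuallyEq_one, hx₀] with x hx hxb
    have hfr := t.isLocalFrameOn_localFrame_baseSet 𝓘(ℝ, E) ∞ b
    have : (fun i ↦ e i x) = (fun i ↦ t.localFrame b i x) := by
      funext i
      rw [he, hx, Pi.one_apply, one_smul]
    rw [this]
    exact ⟨by simp [hx], hfr.linearIndependent hxb, hfr.generating hxb⟩
  · refine contMDiff_of_tsupport fun x hx ↦ ?_
    have hxb : x ∈ t.baseSet := hf (closure_mono (Function.support_mul_subset_left _ _) hx)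
    exact (hfs x).mul (contMDiffAt_localFrameCoeff b hxb (η.contMDiff x) i)
  · by_cases hx : x ∈ t.baseSet
    · conv_lhs => rw [t.eq_sum_localFrameCoeff_smul (I := 𝓘(ℝ, E)) (b := b) (s := η) hx]
      rw [Finset.smul_sum]
      refine Finset.sum_congr rfl fun i _ ↦ ?_
      rw [he, smul_smul, smul_smul]
      congr 1
      ring
    · simp [hf0 hx]

theorem section_sum_apply {ι : Type*} (s : Finset ι) (e : ι → Cₛ^∞⟮𝓘(ℝ, E); F, S⟯) (x : M) :
    (∑ i ∈ s, e i) x = ∑ i ∈ s, e i x := by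
  have := map_sum (ContMDiffSection.coeAddHom 𝓘(ℝ, E) F ∞ S) e s
  rw [← ContMDiffSection.coeAddHom_apply, this, Finset.sum_apply]
  rfl

theorem exists_section_eq (x : M) (v : S x) : ∃ η : Cₛ^∞⟮𝓘(ℝ, E); F, S⟯, η x = v := by
  obtain ⟨e, ψ, he, -⟩ := exists_global_frame (E := E) (F := F) (S := S) x
  obtain ⟨-, -, hs⟩ := he.self_of_nhds
  obtain ⟨c, hc⟩ := (Submodule.mem_span_range_iff_exists_fun ℝ).mp (hs (Submodule.mem_top (x := v)))
  refine ⟨∑ i, c i • e i, ?_⟩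
  rw [← hc, section_sum_apply]
  rfl

/-! ### Representing tensorial functionals -/

theorem contMDiffAt_det {n : ℕ} {A : M → Matrix (Fin n) (Fin n) ℝ} {x₀ : M}
    (hA : ∀ i j, ContMDiffAt 𝓘(ℝ, E) 𝓘(ℝ, ℝ) ∞ (fun x ↦ A x i j) x₀) :
    ContMDiffAt 𝓘(ℝ, E) 𝓘(ℝ, ℝ) ∞ (fun x ↦ (A x).det) x₀ := by
  simp only [Matrix.det_apply']
  exact ContMDiffAt.sum fun σ _ ↦ contMDiffAt_const.mul
    (contMDiffAt_finsetProd fun i _ ↦ hA _ _)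

/-- Cramer's rule: the entries are quotients of determinants. -/
theorem contMDiffAt_matrix_inv {n : ℕ} {A : M → Matrix (Fin n) (Fin n) ℝ} {x₀ : M}
    (hA : ∀ i j, ContMDiffAt 𝓘(ℝ, E) 𝓘(ℝ, ℝ) ∞ (fun x ↦ A x i j) x₀) (h₀ : (A x₀).det ≠ 0)
    (i j : Fin n) : ContMDiffAt 𝓘(ℝ, E) 𝓘(ℝ, ℝ) ∞ (fun x ↦ (A x)⁻¹ i j) x₀ := by
  simp only [Matrix.inv_def, Ring.inverse_eq_inv', Matrix.smul_apply, smul_eq_mul,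
    Matrix.adjugate_apply]
  refine ((contMDiffAt_det hA).inv₀ h₀).mul (contMDiffAt_det fun k l ↦ ?_)
  by_cases h : k = j
  · subst h
    simpa using contMDiffAt_const
  · simpa [Matrix.updateRow_ne h] using hA k l

/-- A `C^∞`-linear functional on sections is represented by a smooth section with respect to a
smooth non-degenerate bilinear form. -/
theorem exists_section_representing (B : ∀ x : M, LinearMap.BilinForm ℝ (S x))
    (hB : ∀ x, (B x).Nondegenerate)
    (hBs : ∀ η ξ : Cₛ^∞⟮𝓘(ℝ, E); F, S⟯,
      ContMDiff 𝓘(ℝ, E) 𝓘(ℝ, ℝ) ∞ fun x ↦ B x (η x) (ξ x))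
    (L : Cₛ^∞⟮𝓘(ℝ, E); F, S⟯ →+ (M → ℝ))
    (hLs : ∀ η, ContMDiff 𝓘(ℝ, E) 𝓘(ℝ, ℝ) ∞ (L η))
    (hL : ∀ (f : M → ℝ) (hf : ContMDiff 𝓘(ℝ, E) 𝓘(ℝ, ℝ) ∞ f) η x,
      L (functionSMul f hf η) x = f x * L η x) :
    ∃ ζ : Cₛ^∞⟮𝓘(ℝ, E); F, S⟯, ∀ η x, B x (η x) (ζ x) = L η x := by
  have loc (x₀ : M) : ∃ ζ : ∀ x, S x,
      ContMDiffAt 𝓘(ℝ, E) (𝓘(ℝ, E).prod 𝓘(ℝ, F)) ∞ (fun x ↦ TotalSpace.mk' F x (ζ x)) x₀ ∧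
      ∀ᶠ x in 𝓝 x₀, ∀ η : Cₛ^∞⟮𝓘(ℝ, E); F, S⟯, B x (η x) (ζ x) = L η x := by
    obtain ⟨e, ψ, he, hψ, hco⟩ := exists_global_frame (E := E) (F := F) (S := S) x₀
    let A (x : M) : Matrix (Fin (Module.finrank ℝ F)) (Fin (Module.finrank ℝ F)) ℝ :=
      Matrix.of fun i j ↦ B x (e i x) (e j x)
    have hA (i j) : ContMDiffAt 𝓘(ℝ, E) 𝓘(ℝ, ℝ) ∞ (fun x ↦ A x i j) x₀ := hBs (e i) (e j) x₀
    have hdet {x : M} (hi : LinearIndependent ℝ (fun i ↦ e i x))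
        (hs : ⊤ ≤ Submodule.span ℝ (Set.range fun i ↦ e i x)) : (A x).det ≠ 0 := by
      have := (LinearMap.BilinForm.nondegenerate_iff_det_ne_zero (Module.Basis.mk hi hs)).mp (hB x)
      convert this using 2
      ext i j
      simp [A, LinearMap.BilinForm.toMatrix_apply]
    -- The coefficients solve the linear system whose matrix is the Gram matrix of the frame.
    let c (j : Fin (Module.finrank ℝ F)) (x : M) : ℝ := ∑ k, (A x)⁻¹ j k * L (e k) x
    have hc (j) : ContMDiffAt 𝓘(ℝ, E) 𝓘(ℝ, ℝ) ∞ (c j) x₀ := by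
      obtain ⟨-, hi, hs⟩ := he.self_of_nhds
      exact ContMDiffAt.sum fun k _ ↦ (contMDiffAt_matrix_inv hA (hdet hi hs) j k).mul (hLs _ x₀)
    refine ⟨fun x ↦ ∑ j, c j x • e j x, ContMDiffAt.sum_section fun j _ ↦
      (hc j).smul_section ((e j).contMDiff x₀), ?_⟩
    filter_upwards [he] with x ⟨hψx, hi, hs⟩ η
    have hframe (i) : B x (e i x) (∑ j, c j x • e j x) = L (e i) x := by
      have hinv : A x * (A x)⁻¹ = 1 := Matrix.mul_nonsing_inv _ (hdet hi hs).isUnit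
      have h1 : (A x).mulVec (fun j ↦ c j x) = fun i ↦ L (e i) x := by
        change (A x).mulVec ((A x)⁻¹.mulVec fun k ↦ L (e k) x) = _
        rw [Matrix.mulVec_mulVec, hinv, Matrix.one_mulVec]
      rw [← congrFun h1 i]
      simp [Matrix.mulVec, dotProduct, A, mul_comm]
    obtain ⟨a, ha, hη⟩ := hco η
    -- `L` acts on global sections only, so $\eta$ is expanded after multiplication by $\psi$;
    -- $C^\infty$-linearity and $\psi=1$ near $x_0$ then recover $L\eta$.
    have hη' : functionSMul ψ hψ η = ∑ i, functionSMul (a i) (ha i) (e i) := by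
      ext y
      rw [section_sum_apply]
      exact hη y
    have hLη := congrArg (fun ζ ↦ L ζ x) hη'
    simp only [map_sum, Finset.sum_apply, hL, hψx, one_mul] at hLη
    have hx := hη x
    rw [hψx, one_smul] at hx
    generalize ∑ j, c j x • e j x = z at hframe ⊢
    rw [hLη, hx, map_sum, LinearMap.sum_apply]
    refine Finset.sum_congr rfl fun i _ ↦ ?_
    rw [map_smul, LinearMap.smul_apply, hframe, smul_eq_mul]
  choose Z hZs hZ using loc
  -- The local solutions glue without a partition of unity, since non-degeneracy makes the
  -- representing vector unique at each point.
  refine ⟨⟨fun x ↦ Z x x, fun x₀ ↦ (hZs x₀).congr_of_eventuallyEq ?_⟩,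
    fun η x ↦ (hZ x).self_of_nhds η⟩
  filter_upwards [hZ x₀] with x hx
  congr 1
  rw [← sub_eq_zero]
  refine (hB x).2 _ fun v ↦ ?_
  obtain ⟨η, rfl⟩ := exists_section_eq (E := E) (F := F) x v
  rw [map_sub, (hZ x).self_of_nhds η, hx η, sub_self]

end Sections

section Connections

variable {E : Type*} [NormedAddCommGroup E] [NormedSpace ℝ E] [FiniteDimensional ℝ E]
  {M : Type*} [TopologicalSpace M] [ChartedSpace E M] [IsManifold 𝓘(ℝ, E) ∞ M]
  {F : Type*} [NormedAddCommGroup F] [NormedSpace ℝ F]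
  {S : M → Type*} [TopologicalSpace (TotalSpace F S)]
  [∀ x, AddCommGroup (S x)] [∀ x, Module ℝ (S x)]
  [∀ x, TopologicalSpace (S x)] [∀ x, IsTopologicalAddGroup (S x)] [∀ x, ContinuousSMul ℝ (S x)]
  [FiberBundle F S] [VectorBundle ℝ F S] [ContMDiffVectorBundle ∞ F S 𝓘(ℝ, E)]

/-! ### Connections as biadditive operators -/

/-- A connection as a biadditive operator on vector fields and sections. -/
def alongHom (D : CovariantDerivative 𝓘(ℝ, E) F S) (hD : D.ContMDiffCovariantDerivative ∞) :
    VField E M →+ Cₛ^∞⟮𝓘(ℝ, E); F, S⟯ →+ Cₛ^∞⟮𝓘(ℝ, E); F, S⟯ :=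
  AddMonoidHom.mk' (fun X ↦ AddMonoidHom.mk' (along D hD X) fun ξ η ↦ by
    ext x
    have h := D.isCovariantDerivativeOn.add (x := x) (mdifferentiableAt_section ξ x)
      (mdifferentiableAt_section η x) (Set.mem_univ x)
    exact congrArg (fun T ↦ T (X x)) h) fun X Y ↦ by
    ext ξ x
    exact (D ξ x).map_add (X x) (Y x)

theorem along_leibniz (D : CovariantDerivative 𝓘(ℝ, E) F S)
    (hD : D.ContMDiffCovariantDerivative ∞) (X : VField E M) {f : M → ℝ}
    (hf : ContMDiff 𝓘(ℝ, E) 𝓘(ℝ, ℝ) ∞ f) (ξ : Cₛ^∞⟮𝓘(ℝ, E); F, S⟯) (x : M) :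
    along D hD X (functionSMul f hf ξ) x =
      f x • along D hD X ξ x + mvfderiv 𝓘(ℝ, E) f x (X x) • ξ x := by
  have h := D.isCovariantDerivativeOn.leibniz (x := x) (mdifferentiableAt_section ξ x)
    ((hf x).mdifferentiableAt (by simp)) (Set.mem_univ x)
  exact congrArg (fun T ↦ T (X x)) h

theorem IsLeviCivita.lieBracket_eq {g : PseudoRiemannianMetric E M}
    {nabla : CovariantDerivative 𝓘(ℝ, E) E (TangentSpace 𝓘(ℝ, E) : M → Type _)}
    (hLC : IsLeviCivita g nabla) (X Y : VField E M) :
    lieBracket X Y = along nabla hLC.contMDiff X Y - along nabla hLC.contMDiff Y X := by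
  ext x
  exact (nabla.torsion_eq_zero_iff.mp hLC.torsion_eq_zero (mdifferentiableAt_section X x)
    (mdifferentiableAt_section Y x)).symm

theorem lieBracket_swap (X Y : VField E M) : lieBracket X Y = -lieBracket Y X := by
  ext x
  exact VectorField.mlieBracket_swap_apply

theorem IsLeviCivita.satisfiesJacobi {g : PseudoRiemannianMetric E M}
    {nabla : CovariantDerivative 𝓘(ℝ, E) E (TangentSpace 𝓘(ℝ, E) : M → Type _)}
    (hLC : IsLeviCivita g nabla) : SatisfiesJacobi (alongHom nabla hLC.contMDiff) := by
  intro X Y Z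
  have h (X Y : VField E M) : alongHom nabla hLC.contMDiff X Y - alongHom nabla hLC.contMDiff Y X =
    lieBracket X Y := (hLC.lieBracket_eq X Y).symm
  rw [h Y Z, h Z X, h X Y, h, h, h, lieBracket_jacobi X Y Z, lieBracket_swap Z (lieBracket X Y),
    lieBracket_swap Z X, ← neg_one_smul ℝ (lieBracket X Z)]
  have hn : lieBracket Y ((-1 : ℝ) • lieBracket X Z) = -lieBracket Y (lieBracket X Z) := by
    have h0 := lieBracket_add_right Y ((-1 : ℝ) • lieBracket X Z) (lieBracket X Z)
    rw [neg_one_smul, neg_add_cancel] at h0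
    have hz := lieBracket_add_right Y 0 0
    rw [add_zero, left_eq_add] at hz
    rw [hz] at h0
    rw [neg_one_smul]
    exact eq_neg_of_add_eq_zero_left h0.symm
  rw [hn]
  abel

end Connections

/-! ### Charge conjugation and the dual connection -/

section Spinors

variable {𝕜 : Type*} [RCLike 𝕜]
  {E : Type*} [NormedAddCommGroup E] [NormedSpace ℝ E] [FiniteDimensional ℝ E]
  {M : Type*} [TopologicalSpace M] [ChartedSpace E M] [IsManifold 𝓘(ℝ, E) ∞ M]
  {F : Type*} [NormedAddCommGroup F] [NormedSpace ℝ F]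
  {S : M → Type*} [TopologicalSpace (TotalSpace F S)]
  [∀ x, AddCommGroup (S x)] [∀ x, Module ℝ (S x)] [∀ x, Module 𝕜 (S x)]
  [∀ x, IsScalarTower ℝ 𝕜 (S x)]
  [∀ x, TopologicalSpace (S x)] [∀ x, IsTopologicalAddGroup (S x)] [∀ x, ContinuousSMul ℝ (S x)]
  [FiberBundle F S] [VectorBundle ℝ F S]

/-- Product of a constant of `𝕜` and a smooth section. -/
def constSMul [NormedSpace 𝕜 F] [IsScalarTower ℝ 𝕜 F] [VectorBundle 𝕜 F S]
    (c : 𝕜) (ξ : Cₛ^∞⟮𝓘(ℝ, E); F, S⟯) : Cₛ^∞⟮𝓘(ℝ, E); F, S⟯ :=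
  ⟨fun x ↦ c • ξ x, fun x₀ ↦ by
    have h := ξ.contMDiff x₀
    rw [contMDiffAt_section] at h ⊢
    -- In a $\mathbb{k}$-linear trivialization, multiplication by $c$ is this constant map.
    let T : F →L[ℝ] F := (c • ContinuousLinearMap.id 𝕜 F).restrictScalars ℝ
    refine ((T.contMDiff).contMDiffAt.comp x₀ h).congr_of_eventuallyEq ?_
    filter_upwards [(trivializationAt F S x₀).open_baseSet.mem_nhds
      (FiberBundle.mem_baseSet_trivializationAt' x₀)] with x hx
    exact ((trivializationAt F S x₀).linear 𝕜 hx).map_smul c (ξ x)⟩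

namespace SpinorStructure

variable {g : PseudoRiemannianMetric E M} (𝒮 : SpinorStructure 𝕜 F S g)

/-- The real part of the charge conjugation. -/
def reC (x : M) : LinearMap.BilinForm ℝ (S x) :=
  LinearMap.mk₂ ℝ (fun v w ↦ RCLike.re (𝒮.C x v w)) (by simp)
    (fun r v w ↦ by
      rw [(𝒮.C x).map_smul_of_tower, LinearMap.smul_apply, RCLike.smul_re, smul_eq_mul])
    (by simp)
    (fun r v w ↦ by
      rw [(𝒮.C x v).map_smul_of_tower, RCLike.smul_re, smul_eq_mul])

theorem reC_apply (x : M) (v w : S x) : 𝒮.reC x v w = RCLike.re (𝒮.C x v w) := rfl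

/-- Rescaling a test vector by $\overline{C(v,w)}$ turns the real part into $|C(v,w)|^2$. -/
theorem reC_nondegenerate (x : M) : (𝒮.reC x).Nondegenerate := by
  refine ⟨fun v hv ↦ (𝒮.nondegenerate x).1 v fun w ↦ ?_,
    fun w hw ↦ (𝒮.nondegenerate x).2 w fun v ↦ ?_⟩
  · have h := hv ((starRingEnd 𝕜) (𝒮.C x v w) • w)
    rw [reC_apply, map_smul, smul_eq_mul, RCLike.conj_mul, ← RCLike.ofReal_pow,
      RCLike.ofReal_re] at h
    simpa using h
  · have h := hw ((starRingEnd 𝕜) (𝒮.C x v w) • v)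
    rw [reC_apply, map_smul, LinearMap.smul_apply, smul_eq_mul, RCLike.conj_mul,
      ← RCLike.ofReal_pow, RCLike.ofReal_re] at h
    simpa using h

theorem mdifferentiableAt_C (η ξ : Cₛ^∞⟮𝓘(ℝ, E); F, S⟯) (x : M) :
    MDifferentiableAt 𝓘(ℝ, E) 𝓘(ℝ, 𝕜) (fun y ↦ 𝒮.C y (η y) (ξ y)) x :=
  (𝒮.contMDiff_C η ξ x).mdifferentiableAt (by simp)

/-- Clifford multiplication as a biadditive operator. -/
def gammaHom : VField E M →+ Cₛ^∞⟮𝓘(ℝ, E); F, S⟯ →+ Cₛ^∞⟮𝓘(ℝ, E); F, S⟯ :=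
  AddMonoidHom.mk' (fun X ↦ AddMonoidHom.mk' (fun ξ ↦ 𝒮.gamma ![X] ξ) fun ξ η ↦ by
    ext x
    exact (𝒮.γ x (X x)).map_add (ξ x) (η x)) fun X Y ↦ by
    ext ξ x
    exact congrArg (fun T ↦ T (ξ x)) ((𝒮.γ x).map_add (X x) (Y x))

theorem gamma_eq : 𝒮.gamma = oneTensor 𝒮.gammaHom := by
  funext X ξ
  ext x
  rfl

variable [ContMDiffVectorBundle ∞ F S 𝓘(ℝ, E)] (D : SpinorConnection 𝕜 E F S)

/-- The function `X C(η, ξ) - C(D_X η, ξ)`. -/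
def dualFunctional (X : VField E M) (ξ η : Cₛ^∞⟮𝓘(ℝ, E); F, S⟯) (x : M) : 𝕜 :=
  mvfderiv 𝓘(ℝ, E) (fun y ↦ 𝒮.C y (η y) (ξ y)) x (X x) - 𝒮.C x (D.apply X η x) (ξ x)

theorem contMDiff_dualFunctional (X : VField E M) (ξ η : Cₛ^∞⟮𝓘(ℝ, E); F, S⟯) :
    ContMDiff 𝓘(ℝ, E) 𝓘(ℝ, 𝕜) ∞ (𝒮.dualFunctional D X ξ η) :=
  (contMDiff_mvfderiv (𝒮.contMDiff_C η ξ) X).sub (𝒮.contMDiff_C (D.apply X η) ξ)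

theorem dualFunctional_add (X : VField E M) (ξ η η' : Cₛ^∞⟮𝓘(ℝ, E); F, S⟯) (x : M) :
    𝒮.dualFunctional D X ξ (η + η') x =
      𝒮.dualFunctional D X ξ η x + 𝒮.dualFunctional D X ξ η' x := by
  have h := mvfderiv_fun_add (𝒮.mdifferentiableAt_C η ξ x) (𝒮.mdifferentiableAt_C η' ξ x)
  have hD : D.apply X (η + η') = D.apply X η + D.apply X η' :=
    (alongHom D.toCovariantDerivative D.contMDiff X).map_add η η'
  simp only [dualFunctional, hD, ContMDiffSection.coe_add, Pi.add_apply, map_add,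
    LinearMap.add_apply, h, add_apply]
  ring

/-- The two Leibniz terms $(Xf)\,C(\eta,\xi)$ cancel; this tensoriality makes the functional
representable by a section. -/
theorem dualFunctional_functionSMul (X : VField E M) (ξ η : Cₛ^∞⟮𝓘(ℝ, E); F, S⟯)
    (f : M → ℝ) (hf : ContMDiff 𝓘(ℝ, E) 𝓘(ℝ, ℝ) ∞ f) (x : M) :
    𝒮.dualFunctional D X ξ (functionSMul f hf η) x = f x • 𝒮.dualFunctional D X ξ η x := by
  have h := mvfderiv_fun_smul ((hf x).mdifferentiableAt (by simp)) (𝒮.mdifferentiableAt_C η ξ x)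
  have hD := along_leibniz D.toCovariantDerivative D.contMDiff X hf η x
  have hs (y : M) (r : ℝ) (v w : S y) : 𝒮.C y (r • v) w = r • 𝒮.C y v w := by
    rw [(𝒮.C y).map_smul_of_tower, LinearMap.smul_apply]
  simp only [dualFunctional, SpinorConnection.apply, hD, functionSMul_apply, hs, h, map_add,
    LinearMap.add_apply]
  simp only [add_apply, smul_apply,
    ContinuousLinearMap.smulRight_apply]
  module

theorem dualFunctional_constSMul [NormedSpace 𝕜 F] [IsScalarTower ℝ 𝕜 F] [VectorBundle 𝕜 F S]
    (X : VField E M) (ξ η : Cₛ^∞⟮𝓘(ℝ, E); F, S⟯) (c : 𝕜) (x : M) :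
    𝒮.dualFunctional D X ξ (constSMul c η) x = c * 𝒮.dualFunctional D X ξ η x := by
  have h := mvfderiv_clm_comp (ContinuousLinearMap.mul ℝ 𝕜 c) (𝒮.mdifferentiableAt_C η ξ x) (X x)
  have hD : D.apply X (constSMul c η) x = c • D.apply X η x := D.smul_const c η x (X x)
  have hc (y : M) : constSMul (E := E) c η y = c • η y := rfl
  simp only [ContinuousLinearMap.mul_apply'] at h
  simp only [dualFunctional, hD, hc, map_smul, LinearMap.smul_apply, smul_eq_mul, h]
  ring

section Dual

variable [T2Space M] [NormedSpace 𝕜 F] [IsScalarTower ℝ 𝕜 F] [VectorBundle 𝕜 F S]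
  [FiniteDimensional ℝ F]

theorem section_ext {ζ ζ' : Cₛ^∞⟮𝓘(ℝ, E); F, S⟯}
    (h : ∀ (η : Cₛ^∞⟮𝓘(ℝ, E); F, S⟯) x, 𝒮.C x (η x) (ζ x) = 𝒮.C x (η x) (ζ' x)) : ζ = ζ' := by
  ext x
  rw [← sub_eq_zero]
  refine (𝒮.nondegenerate x).2 _ fun v ↦ ?_
  obtain ⟨η, rfl⟩ := exists_section_eq (E := E) (F := F) x v
  rw [map_sub, h, sub_self]

/-- Existence of the dual connection `D^C`. -/
theorem exists_chargeDual (X : VField E M) (ξ : Cₛ^∞⟮𝓘(ℝ, E); F, S⟯) :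
    ∃ ζ : Cₛ^∞⟮𝓘(ℝ, E); F, S⟯, ∀ η x, 𝒮.C x (η x) (ζ x) = 𝒮.dualFunctional D X ξ η x := by
  have hre : ContMDiff 𝓘(ℝ, 𝕜) 𝓘(ℝ, ℝ) ∞ (RCLike.reCLM : 𝕜 →L[ℝ] ℝ) :=
    ContinuousLinearMap.contMDiff _
  obtain ⟨ζ, hζ⟩ := exists_section_representing 𝒮.reC 𝒮.reC_nondegenerate
    (fun η ξ ↦ hre.comp (𝒮.contMDiff_C η ξ))
    (AddMonoidHom.mk' (fun η x ↦ RCLike.re (𝒮.dualFunctional D X ξ η x)) fun η η' ↦ by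
      funext x
      simp [dualFunctional_add])
    (fun η ↦ hre.comp (𝒮.contMDiff_dualFunctional D X ξ η))
    (fun f hf η x ↦ by
      simp [dualFunctional_functionSMul, RCLike.smul_re])
  refine ⟨ζ, fun η x ↦ ?_⟩
  rw [← sub_eq_zero]
  -- So far only real parts agree. Testing with $\bar z\eta$, where $z$ is the discrepancy, gives
  -- $|z|^2=0$.
  set z := 𝒮.C x (η x) (ζ x) - 𝒮.dualFunctional D X ξ η x with hz
  have h := hζ (constSMul ((starRingEnd 𝕜) z) η) x
  have hc : constSMul (E := E) ((starRingEnd 𝕜) z) η x = (starRingEnd 𝕜) z • η x := rfl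
  rw [reC_apply, AddMonoidHom.mk'_apply, dualFunctional_constSMul, hc, map_smul,
    LinearMap.smul_apply, smul_eq_mul, ← sub_eq_zero, ← map_sub, ← mul_sub, ← hz,
    RCLike.conj_mul, ← RCLike.ofReal_pow, RCLike.ofReal_re] at h
  simpa using h

theorem chargeDual_spec (X : VField E M) (ξ η : Cₛ^∞⟮𝓘(ℝ, E); F, S⟯) (x : M) :
    mvfderiv 𝓘(ℝ, E) (fun y ↦ 𝒮.C y (η y) (ξ y)) x (X x) =
      𝒮.C x (D.apply X η x) (ξ x) + 𝒮.C x (η x) (𝒮.chargeDual D.apply X ξ x) := by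
  obtain ⟨ζ, hζ⟩ := 𝒮.exists_chargeDual D X ξ
  refine Classical.epsilon_spec (p := fun ζ : Cₛ^∞⟮𝓘(ℝ, E); F, S⟯ ↦
    ∀ (η : Cₛ^∞⟮𝓘(ℝ, E); F, S⟯) (x : M),
      mvfderiv 𝓘(ℝ, E) (fun y ↦ 𝒮.C y (η y) (ξ y)) x (X x) =
        𝒮.C x (D.apply X η x) (ξ x) + 𝒮.C x (η x) (ζ x)) ⟨ζ, fun η x ↦ ?_⟩ η x
  rw [hζ, dualFunctional]
  ring

theorem C_chargeDual (X : VField E M) (ξ η : Cₛ^∞⟮𝓘(ℝ, E); F, S⟯) (x : M) :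
    𝒮.C x (η x) (𝒮.chargeDual D.apply X ξ x) =
      mvfderiv 𝓘(ℝ, E) (fun y ↦ 𝒮.C y (η y) (ξ y)) x (X x) - 𝒮.C x (D.apply X η x) (ξ x) := by
  rw [chargeDual_spec]
  ring

/-- The connection `D^C` as a biadditive operator. -/
def chargeDualHom : VField E M →+ Cₛ^∞⟮𝓘(ℝ, E); F, S⟯ →+ Cₛ^∞⟮𝓘(ℝ, E); F, S⟯ :=
  AddMonoidHom.mk' (fun X ↦ AddMonoidHom.mk' (𝒮.chargeDual D.apply X) fun ξ ξ' ↦ by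
    refine 𝒮.section_ext fun η x ↦ ?_
    have h := mvfderiv_fun_add (𝒮.mdifferentiableAt_C η ξ x) (𝒮.mdifferentiableAt_C η ξ' x)
    simp only [C_chargeDual, ContMDiffSection.coe_add, Pi.add_apply, map_add, h,
      add_apply]
    ring) fun X Y ↦ by
    ext1 ξ
    refine 𝒮.section_ext fun η x ↦ ?_
    have hD : D.apply (X + Y) η = D.apply X η + D.apply Y η :=
      congrArg (fun T ↦ T η) ((alongHom D.toCovariantDerivative D.contMDiff).map_add X Y)
    simp only [AddMonoidHom.mk'_apply, AddMonoidHom.add_apply, C_chargeDual,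
      ContMDiffSection.coe_add, Pi.add_apply, map_add, hD, LinearMap.add_apply]
    ring

/-- The curvatures of `D` and `D^C` are opposite with respect to `C`. -/
theorem C_curvature (X : Fin 2 → VField E M) (η ξ : Cₛ^∞⟮𝓘(ℝ, E); F, S⟯) (x : M) :
    𝒮.C x (η x) (curvature (𝒮.chargeDual D.apply) X ξ x) =
      -𝒮.C x (curvature D.apply X η x) (ξ x) := by
  have second (X Y : VField E M) :
      mvfderiv 𝓘(ℝ, E) (fun y ↦ mvfderiv 𝓘(ℝ, E) (fun z ↦ 𝒮.C z (η z) (ξ z)) y (Y y)) x (X x) =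
      𝒮.C x (D.apply X (D.apply Y η) x) (ξ x) +
        𝒮.C x (D.apply Y η x) (𝒮.chargeDual D.apply X ξ x) +
        (𝒮.C x (D.apply X η x) (𝒮.chargeDual D.apply Y ξ x) +
        𝒮.C x (η x) (𝒮.chargeDual D.apply X (𝒮.chargeDual D.apply Y ξ) x)) := by
    simp only [𝒮.chargeDual_spec D Y ξ η]
    rw [mvfderiv_fun_add (𝒮.mdifferentiableAt_C _ _ x) (𝒮.mdifferentiableAt_C _ _ x),
      add_apply, 𝒮.chargeDual_spec D X, 𝒮.chargeDual_spec D X]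
  -- In the commutator of second derivatives, the mixed terms with one $D$ and one $D^C$ are
  -- symmetric and cancel.
  have h := mvfderiv_lieBracket (𝒮.contMDiff_C η ξ) (X 0) (X 1) x
  rw [second, second, 𝒮.chargeDual_spec D] at h
  simp only [curvature, ContMDiffSection.coe_sub, Pi.sub_apply, map_sub, LinearMap.sub_apply]
  linear_combination -h

/-- `C_curvature` with the two slots of $C$ exchanged; the sign $\Delta_0$ occurs on both sides. -/
theorem chargeAdjoint_curvature (X : Fin 2 → VField E M) (ξ : Cₛ^∞⟮𝓘(ℝ, E); F, S⟯) :
    𝒮.chargeAdjoint (curvature D.apply X) ξ = -curvature (𝒮.chargeDual D.apply) X ξ := by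
  have h₀ (η : Cₛ^∞⟮𝓘(ℝ, E); F, S⟯) (x : M) :
      𝒮.C x ((-curvature (𝒮.chargeDual D.apply) X ξ) x) (η x) =
        𝒮.C x (ξ x) (curvature D.apply X η x) := by
    rw [𝒮.symm₀, 𝒮.symm₀ x (ξ x), ContMDiffSection.coe_neg, Pi.neg_apply, map_neg,
      𝒮.C_curvature D, neg_neg]
  have hε := Classical.epsilon_spec (p := fun ζ : Cₛ^∞⟮𝓘(ℝ, E); F, S⟯ ↦
    ∀ (η : Cₛ^∞⟮𝓘(ℝ, E); F, S⟯) (x : M),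
      𝒮.C x (ζ x) (η x) = 𝒮.C x (ξ x) (curvature D.apply X η x)) ⟨_, h₀⟩
  refine 𝒮.section_ext fun η x ↦ ?_
  rw [𝒮.symm₀, 𝒮.symm₀ x (η x), h₀ η x]
  exact congrArg _ (hε η x)

/-- The bridge from $\mathrm{ad}^C$ to the formal identities. Oddness is assumed because an
`EndTensor` is a bare function, with no linearity built in. -/
theorem adC_curvature {k : ℕ} {Φ : EndTensor E F S k} (hΦ : ∀ X ξ, Φ X (-ξ) = -Φ X ξ) :
    𝒮.adC (curvature D.apply) Φ =
      commTensor (curvature D.apply) (curvature (𝒮.chargeDual D.apply)) Φ := by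
  funext W ξ
  simp only [adC, commTensor, chargeAdjoint_curvature, hΦ, sub_eq_add_neg]

end Dual

end SpinorStructure

end Spinors

end SpinorTorsion

end

open SpinorTorsion in
theorem proposition3p8
    {𝕜 : Type*} [RCLike 𝕜]
    -- the manifold
    {E : Type*} [NormedAddCommGroup E] [NormedSpace ℝ E] [FiniteDimensional ℝ E]
    {M : Type*} [TopologicalSpace M] [T2Space M] [ChartedSpace E M] [IsManifold 𝓘(ℝ, E) ∞ M]
    -- the vector bundle
    {F : Type*} [NormedAddCommGroup F] [NormedSpace ℝ F] [NormedSpace 𝕜 F] [IsScalarTower ℝ 𝕜 F]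
    [FiniteDimensional ℝ F]
    {S : M → Type*} [TopologicalSpace (TotalSpace F S)]
    [∀ x, AddCommGroup (S x)] [∀ x, Module ℝ (S x)] [∀ x, Module 𝕜 (S x)]
    [∀ x, IsScalarTower ℝ 𝕜 (S x)]
    [∀ x, TopologicalSpace (S x)] [∀ x, IsTopologicalAddGroup (S x)]
    [∀ x, ContinuousSMul ℝ (S x)]
    [FiberBundle F S] [VectorBundle ℝ F S] [VectorBundle 𝕜 F S]
    [ContMDiffVectorBundle ∞ F S 𝓘(ℝ, E)]
    -- metric, Levi-Civita connection, spinor structure, connection on spinors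
    (g : PseudoRiemannianMetric E M)
    (nabla : CovariantDerivative 𝓘(ℝ, E) E (TangentSpace 𝓘(ℝ, E) : M → Type _))
    (hLC : IsLeviCivita g nabla)
    (𝒮 : SpinorStructure 𝕜 F S g)
    (D : SpinorConnection 𝕜 E F S) :
    alt (𝒮.hatD hLC D (𝒮.torsion hLC D)) = alt (𝒮.adC (curvature D.apply) 𝒮.gamma) ∧
    alt (𝒮.hatD hLC D (𝒮.adC (curvature D.apply) 𝒮.gamma)) =
      (1 / 2 : ℝ) • alt (𝒮.adC (curvature D.apply) (𝒮.torsion hLC D)) ∧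
    alt (inducedD (along nabla hLC.contMDiff) D.apply D.apply (curvature D.apply)) = 0 := by
  let N := alongHom nabla hLC.contMDiff
  let d := alongHom D.toCovariantDerivative D.contMDiff
  let d' := 𝒮.chargeDualHom D
  let H := inducedD (fun X Y ↦ N X Y) (fun X ξ ↦ d X ξ) (fun X ξ ↦ d' X ξ)
    (oneTensor 𝒮.gammaHom)
  have hJ : SatisfiesJacobi N := hLC.satisfiesJacobi
  -- Torsion-freeness trades the Lie bracket for the commutator of $\nabla$.
  have hR : curvature D.apply = torsionFreeCurvature N d := by
    funext X ξ
    rw [curvature, hLC.lieBracket_eq]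
    rfl
  have hR' : curvature (𝒮.chargeDual D.apply) = torsionFreeCurvature N d' := by
    funext X ξ
    rw [curvature, hLC.lieBracket_eq]
    rfl
  have hhat {k : ℕ} (Φ : EndTensor E F S k) : 𝒮.hatD hLC D Φ =
      inducedD (fun X Y ↦ N X Y) (fun X ξ ↦ d X ξ) (fun X ξ ↦ d' X ξ) Φ := rfl
  have hHdef : 𝒮.hatD hLC D 𝒮.gamma = H := by
    rw [𝒮.gamma_eq, hhat]
  have hHneg (X ξ) : H X (-ξ) = -H X ξ := by
    simp only [H, inducedD_one, oneTensor, map_neg]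
    abel
  have hT : 𝒮.torsion hLC D = (2 : ℝ) • alt H := by
    rw [SpinorStructure.torsion, hHdef]
  have hTneg (X ξ) : 𝒮.torsion hLC D X (-ξ) = -𝒮.torsion hLC D X ξ := by
    rw [hT, two_smul_alt_two]
    simp only [EndTensor.permute, Pi.sub_apply, hHneg]
    abel
  have hadγ : 𝒮.adC (curvature D.apply) 𝒮.gamma =
      commTensor (torsionFreeCurvature N d) (torsionFreeCurvature N d')
        (oneTensor 𝒮.gammaHom) := by
    rw [𝒮.adC_curvature D, hR, hR', 𝒮.gamma_eq]
    intro X ξ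
    rw [𝒮.gamma_eq]
    exact (𝒮.gammaHom (X 0)).map_neg ξ
  refine ⟨?_, ?_, ?_⟩
  · rw [hT, hadγ, hhat]
    exact (alt_inducedD_torsion H).trans (alt_inducedD_inducedD hJ)
  -- The factor $\tfrac12$ cancels the 2 in the definition of the torsion.
  · rw [hadγ, hhat, 𝒮.adC_curvature D hTneg, hR, hR', hT, alt_commTensor_torsion, smul_smul]
    · rw [one_div, inv_mul_cancel₀ two_ne_zero, one_smul]
      exact alt_inducedD_commTensor hJ
    · intro X ξ η
      simp only [torsionFreeCurvature, map_sub]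
      abel
  · rw [hR]
    exact differential_bianchi (D := d) hJ
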